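/- Let $c\ge 0$ and $\varepsilon\in[0,1]$ be constants with $c\le 1/(1-2\varepsilon)^2$ (no restriction on $c$ if $\varepsilon=1/2$). For each $n$, let $G\sim G(n,c/n)$ be an Erdős–Rényi random graph on $[n]$ (with $c/n$ replaced by $1$ when $n<c$), let $X$ be uniform on $\{-1,+1\}^n$, and let $(Z_e)$ be i.i.d. with $\mathbb P(Z_e=-1)=\varepsilon=1-\mathbb P(Z_e=+1)$, where $G$, $X$, $Z$ are independent. In the censored block model one observes $Y$, consisting of the graph $G$ and the labels $Y_{uv}=X_uX_vZ_{uv}$ on the edges $\{u,v\}$ of $G$. Write $I_2(X_u;X_v\mid Y)$ for the conditional $\chi^2$-mutual information $$I_2(X_u;X_v\mid Y)=\sum_y \mathbb P(Y=y)\sum_{a,b\in\{\pm1\}}p_y(a)\,q_y(b)\Big(\frac{r_y(a,b)}{p_y(a)\,q_y(b)}-1\Big)^2,$$ where $p_y$, $q_y$, $r_y$ are the laws of $X_u$, $X_v$, $(X_u,X_v)$ conditioned on $Y=y$ (terms with $\mathbb P(Y=y)=0$ or $p_y(a)q_y(b)=0$ are omitted). Then weak recovery is impossible, in the following sense. 1.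 $\displaystyle\max_{u\ne v} I_2(X_u;X_v\mid Y)\to 0$ as $n\to\infty$. 2. For every sequence of (possibly randomized) estimators $\hat X=\hat X(Y)\in\{-1,+1\}^n$ and every $\delta>0$, $$\mathbb P\Big(\frac1n\Big|\sum_{i=1}^n X_i\hat X_i\Big|\ge\delta\Big)\to 0 .$$ 3. In particular, weak recovery is not solvable: there are no $\delta>0$ and no sequence of (possibly randomized) estimators $\hat X$ with $\mathbb P\big(\frac1n|\sum_i X_i\hat X_i|\ge\delta\big)\to1$. -/

import Mathlib

open MeasureTheory ProbabilityTheory Filter Topology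

namespace CensoredBlockModel

/-- Vertex spins `±1` on the vertex set `Fin n`. -/
abbrev Spins (n : ℕ) := Fin n → ℤˣ

/-- The label observed at a pair of vertices: `some y` with `y = ±1` if the pair is an edge, and
the blank symbol `none` if it is not. -/
abbrev EdgeLabel := Option ℤˣ

instance : MeasurableSpace EdgeLabel := ⊤

instance : DiscreteMeasurableSpace EdgeLabel := ⟨fun _ => trivial⟩

/-- Everything that the observer sees: a label at each pair of vertices. The blank labels
reveal the non-edges, so the graph is a function of the observation. -/
abbrev Observation (n : ℕ) := Sym2 (Fin n) → EdgeLabel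

/-- The sample space: the graph `G`, the spins `X` and the edge noise `Z`. -/
abbrev Sample (n : ℕ) := SimpleGraph (Fin n) × Spins n × (Sym2 (Fin n) → ℤˣ)

/-- The edge probability `c / n`, truncated to `[0, 1]` (for `0 ≤ c` the truncation only matters
for the finitely many `n < c`). -/
noncomputable def edgeProb (c : ℝ) (n : ℕ) : unitInterval :=
  Set.projIcc 0 1 zero_le_one (c / n)

/-- The joint law of `(G, X, Z)`: independently, `G` is the Erdős–Rényi graph `G(n, c/n)`, `X` is
uniform on `{-1, 1}ⁿ`, and the noise variables are i.i.d., equal to `-1` with probability `ε` and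
to `1` with probability `1 - ε`. -/
noncomputable def law (c : ℝ) (ε : unitInterval) (n : ℕ) : Measure (Sample n) :=
  (SimpleGraph.binomialRandom (Fin n) (edgeProb c n)).prod
    ((uniformOn (Set.univ : Set (Spins n))).prod
      (Measure.pi fun _ : Sym2 (Fin n) => bernoulliMeasure (-1 : ℤˣ) 1 ε))

/-- The planted spins `X`. -/
def spins {n : ℕ} (ω : Sample n) : Spins n := ω.2.1

open Classical in
/-- The observation `Y`: the label `X_u * X_v * Z_e` on each edge `e = {u, v}` of `G`, and a blank
on each pair that is not an edge. -/
noncomputable def observe {n : ℕ} (ω : Sample n) : Observation n := fun e =>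
  if e ∈ ω.1.edgeSet then some ((e.map ω.2.1).mul * ω.2.2 e) else none

/-- The `χ²`-mutual information `∑ p(a) p(b) (p(a, b) / (p(a) p(b)) - 1)²` of two random variables
with finitely many values; terms with `p(a) p(b) = 0` vanish. -/
noncomputable def chiSqInfo {Ω A B : Type*} [MeasurableSpace Ω] [Fintype A] [Fintype B]
    (P : Measure Ω) (U : Ω → A) (V : Ω → B) : ℝ :=
  ∑ a, ∑ b, P.real (U ⁻¹' {a}) * P.real (V ⁻¹' {b}) *
    (P.real (U ⁻¹' {a} ∩ V ⁻¹' {b}) / (P.real (U ⁻¹' {a}) * P.real (V ⁻¹' {b})) - 1) ^ 2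

/-- The conditional `χ²`-mutual information `I₂(U; V | W)`: the average over the value `w` of `W`
of the `χ²`-mutual information of `U` and `V` under the law conditioned on `W = w`. -/
noncomputable def condChiSqInfo {Ω A B C : Type*} [MeasurableSpace Ω] [Fintype A] [Fintype B]
    [Fintype C] (P : Measure Ω) (U : Ω → A) (V : Ω → B) (W : Ω → C) : ℝ :=
  ∑ w, P.real (W ⁻¹' {w}) * chiSqInfo (ProbabilityTheory.cond P (W ⁻¹' {w})) U V

/-- The absolute correlation `|∑ x_i x'_i| / n` of two spin configurations. It is invariant under
a global sign flip, and it equals `2 A - 1` where `A` is the larger of the fraction of coordinates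
on which `x` agrees with `x'` and the fraction on which `x` agrees with `-x'`. -/
noncomputable def overlap {n : ℕ} (x x' : Spins n) : ℝ :=
  |∑ i, (((x i * x' i : ℤˣ) : ℤ) : ℝ)| / n

/-- A (possibly randomized) estimator of the spins from the observation, for each `n`. -/
structure Estimator where
  kernel : ∀ n : ℕ, Kernel (Observation n) (Spins n)
  isMarkov : ∀ n : ℕ, IsMarkovKernel (kernel n)

/-- The probability that the estimate has overlap at least `δ` with the planted spins. -/
noncomputable def overlapProb (c : ℝ) (ε : unitInterval) (est : Estimator) (δ : ℝ) (n : ℕ) :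
    ENNReal :=
  ∫⁻ ω, est.kernel n (observe ω) {x' | δ ≤ overlap (spins ω) x'} ∂(law c ε n)

/-- Weak recovery is solvable: for some `δ > 0`, some estimator has overlap at least `δ` with the
planted spins, with probability tending to one. -/
def WeakRecoverySolvable (c : ℝ) (ε : unitInterval) : Prop :=
  ∃ δ : ℝ, 0 < δ ∧ ∃ est : Estimator, Tendsto (overlapProb c ε est δ) atTop (𝓝 1)

end CensoredBlockModel

/-! The proof is by information percolation. Since the posterior marginals are uniform,
$I_2(X_u;X_v\mid Y)$ equals $\mathbb E[\mathbb E[X_uX_v\mid Y]^2]$ (`condChiSqInfo_eq_pairInfo`). A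
symmetric channel of noise mean $\rho=1-2\varepsilon$ contracts $\chi^2$-information by $\rho^2$
(`symmetric_channel_ineq`). So each noisy edge can be replaced by one that is seen exactly with
probability $q=\min(c/n,1)\rho^2\le 1/n$ and erased otherwise; doing this edge by edge only
increases the information (`meanSqCorr_le_sum_powerset`). With exact or erased edges, $X_uX_v$ is a
fair sign given the data unless $u$ and $v$ are connected by revealed edges. Hence $I_2$ is at most
the probability that $u$ and $v$ are connected in bond percolation with edge probability at most
$1/n$ (`pairInfo_le_percolation`).

A union bound over self-avoiding paths bounds this by $\sum_j n(n-1)\cdots(n-j+1)\,n^{-(j+1)}$,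
which is $1/n$ times a sum of birthday probabilities. Self-avoidance makes long paths rare, so the
sum vanishes even at the critical value (`sum_descFactorial_le`).

For estimation, the mean squared overlap is an average over pairs $(i,j)$: the diagonal contributes
$1/n$, and the other terms are at most $\mathbb E|\mathbb E[X_iX_j\mid Y]|\le\sqrt{I_2}$.
Chebyshev's inequality concludes (`overlapProb_le`). -/

namespace CensoredBlockModel

/-! ### Contraction of squared correlation by one channel -/

/-- The squared correlation `(∑ A f)² / ∑ f` of the observable `A` under the unnormalised
weight `f`. -/
noncomputable def sqCorr {Ω : Type*} [Fintype Ω] (A f : Ω → ℝ) : ℝ :=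
  (∑ x, A x * f x) ^ 2 / ∑ x, f x

/-- Transition weights of the channel which erases its input with probability `1 - κ.1` and
otherwise reveals it multiplied by noise of mean `κ.2`. -/
noncomputable def channel (κ : ℝ × ℝ) : EdgeLabel → ℤˣ → ℝ
  | none, _ => 1 - κ.1
  | some t, s => κ.1 * ((1 + κ.2 * (((t * s : ℤˣ) : ℤ) : ℝ)) / 2)

/-- A channel is admissible if its revealing probability and noise mean are in range. -/
def Admissible (κ : ℝ × ℝ) : Prop := 0 ≤ κ.1 ∧ κ.1 ≤ 1 ∧ -1 ≤ κ.2 ∧ κ.2 ≤ 1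

lemma units_cast_cases (s : ℤˣ) : ((s : ℤ) : ℝ) = 1 ∨ ((s : ℤ) : ℝ) = -1 := by
  rcases Int.units_eq_one_or s with h | h <;> simp [h]

lemma channel_nonneg {κ : ℝ × ℝ} (h : Admissible κ) (l : EdgeLabel) (s : ℤˣ) :
    0 ≤ channel κ l s := by
  obtain ⟨h0, h1, h2, h3⟩ := h
  rcases l with _ | t
  · simpa [channel] using h1
  · rcases units_cast_cases (t * s) with h | h <;> simp only [channel, h] <;>
      exact mul_nonneg h0 (by linarith)

lemma sum_edgeLabel (g : EdgeLabel → ℝ) : ∑ l, g l = g none + (g (some 1) + g (some (-1))) := by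
  rw [Fintype.sum_option, show (Finset.univ : Finset ℤˣ) = {1, -1} from rfl,
    Finset.sum_pair (by decide)]

lemma sum_channel (κ : ℝ × ℝ) (s : ℤˣ) : ∑ l, channel κ l s = 1 := by
  rw [sum_edgeLabel]
  rcases Int.units_eq_one_or s with h | h <;> simp [channel, h] <;> ring

/-- The strong data processing inequality of the binary symmetric channel, for the squared
correlation with the total weights `S₁, S₂` and the correlations `a₁, a₂` on the two inputs. -/
lemma symmetric_channel_ineq {S₁ S₂ a₁ a₂ ρ : ℝ} (h₁ : 0 ≤ S₁) (h₂ : 0 ≤ S₂)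
    (z₁ : S₁ = 0 → a₁ = 0) (z₂ : S₂ = 0 → a₂ = 0) (hρ : -1 ≤ ρ) (hρ' : ρ ≤ 1) :
    ((1 + ρ) / 2 * a₁ + (1 - ρ) / 2 * a₂) ^ 2 / ((1 + ρ) / 2 * S₁ + (1 - ρ) / 2 * S₂) +
      ((1 - ρ) / 2 * a₁ + (1 + ρ) / 2 * a₂) ^ 2 / ((1 - ρ) / 2 * S₁ + (1 + ρ) / 2 * S₂) ≤
    (1 - ρ ^ 2) * ((a₁ + a₂) ^ 2 / (S₁ + S₂)) + ρ ^ 2 * (a₁ ^ 2 / S₁ + a₂ ^ 2 / S₂) := by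
  have key : ∀ c a S : ℝ, (c * a) ^ 2 / (c * S) = c * (a ^ 2 / S) := by
    intro c a S
    rcases eq_or_ne c 0 with rfl | hc
    · simp
    · rcases eq_or_ne S 0 with rfl | hS
      · simp
      · field_simp
  -- If only one input has positive weight, the output carries no information about the input, and
  -- both sides agree.
  rcases h₁.eq_or_lt with e₁ | e₁
  · rw [z₁ e₁.symm, ← e₁]
    simp only [mul_zero, zero_add, key]
    apply le_of_eq
    ring_nf
  rcases h₂.eq_or_lt with e₂ | e₂
  · rw [z₂ e₂.symm, ← e₂]
    simp only [mul_zero, add_zero, key]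
    apply le_of_eq
    ring_nf
  have p₁ : 0 < (1 + ρ) / 2 * S₁ + (1 - ρ) / 2 * S₂ := by
    rcases lt_or_ge ρ 1 with h | h
    · have := mul_nonneg (show 0 ≤ (1 + ρ) / 2 by linarith) h₁
      have := mul_pos (show 0 < (1 - ρ) / 2 by linarith) e₂
      linarith
    · have : ρ = 1 := le_antisymm hρ' h
      subst this; linarith
  have p₂ : 0 < (1 - ρ) / 2 * S₁ + (1 + ρ) / 2 * S₂ := by
    rcases lt_or_ge ρ 1 with h | h
    · have := mul_nonneg (show 0 ≤ (1 + ρ) / 2 by linarith) h₂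
      have := mul_pos (show 0 < (1 - ρ) / 2 by linarith) e₁
      linarith
    · have : ρ = 1 := le_antisymm hρ' h
      subst this; linarith
  set P := (1 + ρ) / 2 * S₁ + (1 - ρ) / 2 * S₂ with hP
  set Q := (1 - ρ) / 2 * S₁ + (1 + ρ) / 2 * S₂ with hQ
  have hS : 0 < S₁ + S₂ := by linarith
  -- Both sides share the value without observation; the gain is governed by the determinant
  -- $a_1S_2-a_2S_1$. The channel multiplies this determinant by $\rho$, and it replaces $S_1S_2$ by
  -- the larger $PQ$.
  have hL : ((1 + ρ) / 2 * a₁ + (1 - ρ) / 2 * a₂) ^ 2 / P +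
      ((1 - ρ) / 2 * a₁ + (1 + ρ) / 2 * a₂) ^ 2 / Q =
      (a₁ + a₂) ^ 2 / (S₁ + S₂) + ρ ^ 2 * (a₁ * S₂ - a₂ * S₁) ^ 2 / ((S₁ + S₂) * (P * Q)) := by
    have : P ≠ 0 := p₁.ne'
    have : Q ≠ 0 := p₂.ne'
    field_simp
    rw [hP, hQ]; ring
  have hR : a₁ ^ 2 / S₁ + a₂ ^ 2 / S₂ =
      (a₁ + a₂) ^ 2 / (S₁ + S₂) + (a₁ * S₂ - a₂ * S₁) ^ 2 / ((S₁ + S₂) * (S₁ * S₂)) := by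
    field_simp; ring
  have hPQ : S₁ * S₂ ≤ P * Q := by
    have : P * Q - S₁ * S₂ = (1 - ρ ^ 2) / 4 * (S₁ - S₂) ^ 2 := by rw [hP, hQ]; ring
    have : 0 ≤ (1 - ρ ^ 2) / 4 * (S₁ - S₂) ^ 2 := mul_nonneg (by nlinarith) (sq_nonneg _)
    linarith
  have hfrac : ρ ^ 2 * (a₁ * S₂ - a₂ * S₁) ^ 2 / ((S₁ + S₂) * (P * Q)) ≤
      ρ ^ 2 * (a₁ * S₂ - a₂ * S₁) ^ 2 / ((S₁ + S₂) * (S₁ * S₂)) := by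
    gcongr
  rw [hL, hR]
  have : ρ ^ 2 * ((a₁ + a₂) ^ 2 / (S₁ + S₂) +
      (a₁ * S₂ - a₂ * S₁) ^ 2 / ((S₁ + S₂) * (S₁ * S₂))) =
      ρ ^ 2 * ((a₁ + a₂) ^ 2 / (S₁ + S₂)) +
      ρ ^ 2 * (a₁ * S₂ - a₂ * S₁) ^ 2 / ((S₁ + S₂) * (S₁ * S₂)) := by ring
  rw [this]
  linarith

lemma sqCorr_smul {Ω : Type*} [Fintype Ω] (A f : Ω → ℝ) (c : ℝ) :
    sqCorr A (fun x => f x * c) = c * sqCorr A f := by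
  simp only [sqCorr, ← mul_assoc, ← Finset.sum_mul]
  rcases eq_or_ne c 0 with rfl | hc
  · simp
  · rcases eq_or_ne (∑ x, f x) 0 with h | h
    · simp [h]
    · field_simp

/-- Observing `D` through an erasing symmetric channel is dominated by observing it exactly with
probability `κ.1 * κ.2 ^ 2`. -/
lemma sum_sqCorr_channel_le {Ω : Type*} [Fintype Ω] (A f : Ω → ℝ) (hf : ∀ x, 0 ≤ f x)
    (D : Ω → ℤˣ) {κ : ℝ × ℝ} (hκ : Admissible κ) :
    ∑ l, sqCorr A (fun x => f x * channel κ l (D x)) ≤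
      (1 - κ.1 * κ.2 ^ 2) * ∑ l, sqCorr A (fun x => f x * channel (0, 0) l (D x)) +
      κ.1 * κ.2 ^ 2 * ∑ l, sqCorr A (fun x => f x * channel (1, 1) l (D x)) := by
  classical
  obtain ⟨r, ρ⟩ := κ
  obtain ⟨h0, h1, h2, h3⟩ := hκ
  simp only at h0 h1 h2 h3 ⊢
  -- The weight is split by the value of `D`; the total weights and correlations of the two pieces
  -- are the $S_i$ and $a_i$ of `symmetric_channel_ineq`.
  set f₁ : Ω → ℝ := fun x => if D x = 1 then f x else 0 with hf₁
  set f₂ : Ω → ℝ := fun x => if D x = 1 then 0 else f x with hf₂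
  have split : ∀ a b : ℝ, ∀ g : Ω → ℝ, (∀ x, g x = a * f₁ x + b * f₂ x) →
      sqCorr A g = (a * ∑ x, A x * f₁ x + b * ∑ x, A x * f₂ x) ^ 2 /
        (a * ∑ x, f₁ x + b * ∑ x, f₂ x) := by
    intro a b g hg
    simp only [sqCorr, hg, mul_add, Finset.sum_add_distrib, Finset.mul_sum]
    simp only [mul_left_comm]
  have e₁ : ∀ ρ' x, f x * ((1 + ρ' * (((1 * D x : ℤˣ) : ℤ) : ℝ)) / 2) =
      (1 + ρ') / 2 * f₁ x + (1 - ρ') / 2 * f₂ x := by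
    intro ρ' x
    rcases Int.units_eq_one_or (D x) with h | h <;> simp [hf₁, hf₂, h] <;> ring
  have e₂ : ∀ ρ' x, f x * ((1 + ρ' * (((-1 * D x : ℤˣ) : ℤ) : ℝ)) / 2) =
      (1 - ρ') / 2 * f₁ x + (1 + ρ') / 2 * f₂ x := by
    intro ρ' x
    rcases Int.units_eq_one_or (D x) with h | h <;> simp [hf₁, hf₂, h] <;> ring
  have e₀ : ∀ x, f x = 1 * f₁ x + 1 * f₂ x := by
    intro x
    by_cases h : D x = 1 <;> simp [hf₁, hf₂, h]
  have hall : ∀ r' ρ' : ℝ, ∑ l, sqCorr A (fun x => f x * channel (r', ρ') l (D x)) =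
      (1 - r') * sqCorr A f + r' * (
        sqCorr A (fun x => f x * ((1 + ρ' * (((1 * D x : ℤˣ) : ℤ) : ℝ)) / 2)) +
        sqCorr A (fun x => f x * ((1 + ρ' * (((-1 * D x : ℤˣ) : ℤ) : ℝ)) / 2))) := by
    intro r' ρ'
    rw [sum_edgeLabel, mul_add, ← sqCorr_smul, ← sqCorr_smul, ← sqCorr_smul]
    simp only [channel, mul_comm, mul_left_comm]
  rw [hall, hall, hall, split _ _ _ (e₁ ρ), split _ _ _ (e₂ ρ), split _ _ _ (e₁ 1),
    split _ _ _ (e₂ 1), split _ _ _ e₀]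
  have n₁ : ∀ x, 0 ≤ f₁ x := fun x => by simp only [hf₁]; split_ifs <;> simp [hf]
  have n₂ : ∀ x, 0 ≤ f₂ x := fun x => by simp only [hf₂]; split_ifs <;> simp [hf]
  have z : ∀ g : Ω → ℝ, (∀ x, 0 ≤ g x) → ∑ x, g x = 0 → ∑ x, A x * g x = 0 := by
    intro g hg h
    rw [Finset.sum_eq_zero_iff_of_nonneg (fun x _ => hg x)] at h
    exact Finset.sum_eq_zero fun x hx => by rw [h x hx, mul_zero]
  have := mul_le_mul_of_nonneg_left (symmetric_channel_ineq (Finset.sum_nonneg fun x _ => n₁ x)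
    (Finset.sum_nonneg fun x _ => n₂ x) (z f₁ n₁) (z f₂ n₂) h2 h3) h0
  norm_num at this ⊢
  linarith

/-! ### Replacing noisy observations by erasures, one at a time -/

section Expansion

variable {Ω E : Type*} [Fintype Ω] [Fintype E] [DecidableEq E]

/-- The mean squared correlation of `A` given the observation of every `D e` through its own
channel `κ e`, under the prior weight `f`. -/
noncomputable def meanSqCorr (A f : Ω → ℝ) (D : E → Ω → ℤˣ) (κ : E → ℝ × ℝ) : ℝ :=
  ∑ y : E → EdgeLabel, sqCorr A (fun x => f x * ∏ e, channel (κ e) (y e) (D e x))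

/-- Isolates the observation at `e`. The remaining factors are written with `κ` although `κ'` is
observed, so that families differing only at `e` share the same residual weight. -/
lemma meanSqCorr_eq_sum_sum (A f : Ω → ℝ) (D : E → Ω → ℤˣ) (κ κ' : E → ℝ × ℝ) (e : E)
    (h : ∀ j, j ≠ e → κ' j = κ j) :
    meanSqCorr A f D κ' = ∑ z : {j // j ≠ e} → EdgeLabel, ∑ l,
      sqCorr A (fun x => (f x * ∏ j : {j // j ≠ e}, channel (κ j) (z j) (D j x)) *
        channel (κ' e) l (D e x)) := by
  rw [meanSqCorr, ← (Equiv.funSplitAt e EdgeLabel).symm.sum_comp, Fintype.sum_prod_type,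
    Finset.sum_comm]
  refine Finset.sum_congr rfl fun z _ => Finset.sum_congr rfl fun l _ => ?_
  congr 1
  funext x
  rw [Fintype.prod_eq_mul_prod_subtype_ne _ e, mul_assoc]
  congr 1
  rw [mul_comm]
  congr 1
  · refine Finset.prod_congr rfl fun j _ => ?_
    simp [Equiv.funSplitAt, Equiv.piSplitAt, j.2, h j j.2]
  · simp [Equiv.funSplitAt, Equiv.piSplitAt]

/-- The one-channel inequality holds for any nonnegative weight, so the likelihood of all other
observations can be absorbed into the prior. -/
lemma meanSqCorr_le_add (A f : Ω → ℝ) (hf : ∀ x, 0 ≤ f x) (D : E → Ω → ℤˣ)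
    (κ κ₀ κ₁ : E → ℝ × ℝ) (hκ : ∀ e, Admissible (κ e)) (e : E)
    (h₀ : ∀ j, j ≠ e → κ₀ j = κ j) (e₀ : κ₀ e = (0, 0))
    (h₁ : ∀ j, j ≠ e → κ₁ j = κ j) (e₁ : κ₁ e = (1, 1)) :
    meanSqCorr A f D κ ≤
      (1 - (κ e).1 * (κ e).2 ^ 2) * meanSqCorr A f D κ₀ +
      (κ e).1 * (κ e).2 ^ 2 * meanSqCorr A f D κ₁ := by
  rw [meanSqCorr_eq_sum_sum A f D κ κ e fun _ _ => rfl, meanSqCorr_eq_sum_sum A f D κ κ₀ e h₀,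
    meanSqCorr_eq_sum_sum A f D κ κ₁ e h₁, e₀, e₁, Finset.mul_sum, Finset.mul_sum,
    ← Finset.sum_add_distrib]
  refine Finset.sum_le_sum fun z _ => ?_
  have hn : ∀ x, 0 ≤ f x * ∏ j : {j // j ≠ e}, channel (κ j) (z j) (D j x) := fun x =>
    mul_nonneg (hf x) (Finset.prod_nonneg fun j _ => channel_nonneg (hκ j) _ _)
  exact sum_sqCorr_channel_le A _ hn (D e) (hκ e)

/-- Averaging over the set `S` of the observations in `T` that are made exactly, the others in `T`
being erased, dominates the mean squared correlation. -/
lemma meanSqCorr_le_sum_powerset (A f : Ω → ℝ) (hf : ∀ x, 0 ≤ f x) (D : E → Ω → ℤˣ)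
    (κ : E → ℝ × ℝ) (hκ : ∀ e, Admissible (κ e)) (T : Finset E) :
    meanSqCorr A f D κ ≤ ∑ S ∈ T.powerset,
      ((∏ e ∈ S, (κ e).1 * (κ e).2 ^ 2) * ∏ e ∈ T \ S, (1 - (κ e).1 * (κ e).2 ^ 2)) *
      meanSqCorr A f D (fun e => if e ∈ S then (1, 1) else if e ∈ T then (0, 0) else κ e) := by
  have hq : ∀ e, 0 ≤ (κ e).1 * (κ e).2 ^ 2 ∧ (κ e).1 * (κ e).2 ^ 2 ≤ 1 := by
    intro e
    obtain ⟨h0, h1, h2, h3⟩ := hκ e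
    have : (κ e).2 ^ 2 ≤ 1 := by nlinarith
    exact ⟨by positivity, mul_le_one₀ h1 (sq_nonneg _) this⟩
  induction T using Finset.induction_on with
  | empty => simp
  | insert a T ha ih =>
    refine ih.trans ?_
    rw [Finset.sum_powerset_insert ha, ← Finset.sum_add_distrib]
    refine Finset.sum_le_sum fun S hS => ?_
    have hST := Finset.mem_powerset.1 hS
    have haS : a ∉ S := fun h => ha (hST h)
    set κ' : E → ℝ × ℝ := fun e => if e ∈ S then (1, 1) else if e ∈ T then (0, 0) else κ e
      with hκ'
    have hadm : ∀ e, Admissible (κ' e) := by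
      intro e
      simp only [hκ']
      split_ifs
      · norm_num [Admissible]
      · norm_num [Admissible]
      · exact hκ e
    have hκa : κ' a = κ a := by simp [hκ', haS, ha]
    -- The observation at `a` is still noisy in `κ'`. Erasing it or revealing it gives the terms of
    -- `S` and `insert a S` in the larger powerset.
    have hstep := meanSqCorr_le_add A f hf D κ'
      (fun e => if e ∈ S then (1, 1) else if e ∈ insert a T then (0, 0) else κ e)
      (fun e => if e ∈ insert a S then (1, 1) else if e ∈ insert a T then (0, 0) else κ e)
      hadm a (fun j hj => by simp [hκ', hj]) (by simp [haS]) (fun j hj => by simp [hκ', hj])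
      (by simp)
    rw [hκa] at hstep
    have d0 : insert a T \ S = insert a (T \ S) := Finset.insert_sdiff_of_notMem _ haS
    have d1 : insert a T \ insert a S = T \ S := by
      ext e; simp only [Finset.mem_sdiff, Finset.mem_insert]; grind
    have haTS : a ∉ T \ S := fun h => ha (Finset.mem_sdiff.1 h).1
    rw [d0, d1, Finset.prod_insert haTS, Finset.prod_insert haS]
    have hw : 0 ≤ (∏ e ∈ S, (κ e).1 * (κ e).2 ^ 2) *
        ∏ e ∈ T \ S, (1 - (κ e).1 * (κ e).2 ^ 2) :=
      mul_nonneg (Finset.prod_nonneg fun e _ => (hq e).1)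
        (Finset.prod_nonneg fun e _ => by linarith [(hq e).2])
    refine (mul_le_mul_of_nonneg_left hstep hw).trans (le_of_eq ?_)
    ring

lemma sqCorr_le_sum (A f : Ω → ℝ) (hA : ∀ x, |A x| ≤ 1) (hf : ∀ x, 0 ≤ f x) :
    sqCorr A f ≤ ∑ x, f x := by
  have h0 : 0 ≤ ∑ x, f x := Finset.sum_nonneg fun x _ => hf x
  have h : |∑ x, A x * f x| ≤ ∑ x, f x := by
    refine (Finset.abs_sum_le_sum_abs _ _).trans (Finset.sum_le_sum fun x _ => ?_)
    rw [abs_mul, abs_of_nonneg (hf x)]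
    exact mul_le_of_le_one_left (hf x) (hA x)
  rw [sqCorr, ← sq_abs]
  refine div_le_of_le_mul₀ h0 h0 ?_
  nlinarith [abs_nonneg (∑ x, A x * f x)]

lemma sum_prod_channel {Ω E : Type*} [Fintype E] [DecidableEq E] (D : E → Ω → ℤˣ)
    (κ : E → ℝ × ℝ) (x : Ω) :
    ∑ y : E → EdgeLabel, ∏ e, channel (κ e) (y e) (D e x) = 1 := by
  have := Finset.prod_univ_sum (fun _ : E => (Finset.univ : Finset EdgeLabel))
    (fun e l => channel (κ e) l (D e x))
  rw [Fintype.piFinset_univ] at this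
  rw [← this]
  exact Finset.prod_eq_one fun e _ => sum_channel _ _

lemma meanSqCorr_le_one (A f : Ω → ℝ) (hA : ∀ x, |A x| ≤ 1) (hf : ∀ x, 0 ≤ f x)
    (hf1 : ∑ x, f x = 1) (D : E → Ω → ℤˣ) (κ : E → ℝ × ℝ) (hκ : ∀ e, Admissible (κ e)) :
    meanSqCorr A f D κ ≤ 1 := by
  refine (Finset.sum_le_sum fun y _ => sqCorr_le_sum A _ hA fun x => mul_nonneg (hf x)
    (Finset.prod_nonneg fun e _ => channel_nonneg (hκ e) _ _)).trans (le_of_eq ?_)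
  rw [Finset.sum_comm]
  simp only [← Finset.mul_sum, sum_prod_channel, mul_one, hf1]

/-- If a symmetry of the prior flips `A` and fixes every `D e` whose channel does not always
erase, the observations say nothing about `A`. -/
lemma meanSqCorr_eq_zero_of_symm (A f : Ω → ℝ) (D : E → Ω → ℤˣ) (κ : E → ℝ × ℝ) (σ : Ω ≃ Ω)
    (hA : ∀ x, A (σ x) = -A x) (hf : ∀ x, f (σ x) = f x)
    (hD : ∀ e x, (κ e).1 = 0 ∨ D e (σ x) = D e x) :
    meanSqCorr A f D κ = 0 := by
  refine Finset.sum_eq_zero fun y _ => ?_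
  have hch : ∀ e x, channel (κ e) (y e) (D e (σ x)) = channel (κ e) (y e) (D e x) := by
    intro e x
    rcases hD e x with h | h
    · cases y e <;> simp [channel, h]
    · rw [h]
  have : ∑ x, A x * (f x * ∏ e, channel (κ e) (y e) (D e x)) =
      -∑ x, A x * (f x * ∏ e, channel (κ e) (y e) (D e x)) := by
    conv_lhs => rw [← σ.sum_comp]
    simp only [hA, hf, hch, neg_mul, Finset.sum_neg_distrib]
  rw [sqCorr, show ∑ x, A x * (f x * ∏ e, channel (κ e) (y e) (D e x)) = 0 by linarith]
  simp

end Expansion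


/-! ### Bond percolation and self-avoiding paths -/

/-- A random subset containing each `e ∈ U` independently with probability `q e` contains
`T ⊆ U` with probability `∏ e ∈ T, q e`. -/
lemma sum_powerset_weight_of_subset {E : Type*} [DecidableEq E] (q : E → ℝ) {T U : Finset E}
    (hTU : T ⊆ U) :
    ∑ S ∈ U.powerset, ((∏ e ∈ S, q e) * ∏ e ∈ U \ S, (1 - q e)) * (if T ⊆ S then 1 else 0) =
      ∏ e ∈ T, q e := by
  -- The factor $1-q_e$ is replaced by $0$ on `T`, so in the expanded product only the sets `S`
  -- containing `T` survive.
  have h := Finset.prod_add q (fun e => if e ∈ T then 0 else 1 - q e) U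
  have hl : ∏ e ∈ U, (q e + if e ∈ T then 0 else 1 - q e) = ∏ e ∈ T, q e := by
    rw [← Finset.prod_sdiff hTU]
    rw [Finset.prod_eq_one (s := U \ T), one_mul]
    · exact Finset.prod_congr rfl fun e he => by simp [he]
    · intro e he
      simp [(Finset.mem_sdiff.1 he).2]
  rw [← hl, h]
  refine Finset.sum_congr rfl fun S hS => ?_
  rw [mul_assoc]
  congr 1
  by_cases hTS : T ⊆ S
  · rw [if_pos hTS, mul_one]
    refine Finset.prod_congr rfl fun e he => ?_
    rw [if_neg fun h => (Finset.mem_sdiff.1 he).2 (hTS h)]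
  · rw [if_neg hTS, mul_zero]
    obtain ⟨e, heT, heS⟩ := Finset.not_subset.1 hTS
    refine (Finset.prod_eq_zero (i := e) (Finset.mem_sdiff.2 ⟨hTU heT, heS⟩) ?_).symm
    simp [heT]

open Classical in
/-- The self-avoiding walks of length `k` between two vertices of the complete graph. -/
noncomputable def completePaths {n : ℕ} (u v : Fin n) (k : ℕ) :
    Finset ((⊤ : SimpleGraph (Fin n)).Walk u v) :=
  ((⊤ : SimpleGraph (Fin n)).finsetWalkLength k u v).filter fun p => p.IsPath

lemma mem_completePaths {n : ℕ} {u v : Fin n} {k : ℕ} {p : (⊤ : SimpleGraph (Fin n)).Walk u v} :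
    p ∈ completePaths u v k ↔ p.length = k ∧ p.IsPath := by
  classical
  rw [completePaths, Finset.mem_filter, SimpleGraph.mem_finsetWalkLength_iff]

/-- A path of length $j+1$ with fixed ends is determined by its $j$ interior vertices, which are
distinct. -/
lemma card_completePaths_le {n : ℕ} (u v : Fin n) (j : ℕ) :
    (completePaths u v (j + 1)).card ≤ n.descFactorial j := by
  classical
  have hcard : Fintype.card (Fin j ↪ Fin n) = n.descFactorial j := by
    rw [Fintype.card_embedding_eq, Fintype.card_fin, Fintype.card_fin]
  rw [← hcard, ← Fintype.card_coe]
  refine Fintype.card_le_of_injective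
    (fun p => (⟨fun i => p.1.getVert (i + 1), fun a b hab => ?_⟩ : Fin j ↪ Fin n)) ?_
  · obtain ⟨hl, hp⟩ := mem_completePaths.1 p.2
    have := hp.getVert_injOn (show (a : ℕ) + 1 ≤ p.1.length by omega)
      (show (b : ℕ) + 1 ≤ p.1.length by omega) hab
    exact Fin.ext (by omega)
  · intro p p' h
    obtain ⟨hl, -⟩ := mem_completePaths.1 p.2
    obtain ⟨hl', -⟩ := mem_completePaths.1 p'.2
    refine Subtype.ext (SimpleGraph.Walk.ext_getVert_le_length (by omega) fun i hi => ?_)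
    rcases i with _ | i
    · simp
    · rcases Nat.lt_or_ge i j with hij | hij
      · exact DFunLike.congr_fun h ⟨i, hij⟩
      · have e1 : i + 1 = p.1.length := by omega
        have e2 : i + 1 = p'.1.length := by omega
        rw [e1, SimpleGraph.Walk.getVert_length, ← e1, e2, SimpleGraph.Walk.getVert_length]

open Classical in
/-- Two distinct vertices which are connected through `S` are joined by a self-avoiding walk of
the complete graph with edges in `S`. -/
lemma exists_completePath_of_reachable {n : ℕ} {u v : Fin n} (huv : u ≠ v)
    {S : Finset (Sym2 (Fin n))}
    (h : (SimpleGraph.fromEdgeSet (S : Set (Sym2 (Fin n)))).Reachable u v) :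
    ∃ j ∈ Finset.range n, ∃ p ∈ completePaths u v (j + 1), p.edges.toFinset ⊆ S := by
  obtain ⟨p, hp⟩ := h.exists_isPath
  have hpos : p.length ≠ 0 := fun h0 => huv (SimpleGraph.Walk.eq_of_length_eq_zero h0)
  have hlt := hp.length_lt
  rw [Fintype.card_fin] at hlt
  refine ⟨p.length - 1, Finset.mem_range.2 (by omega), p.mapLe le_top,
    mem_completePaths.2 ⟨?_, ?_⟩, ?_⟩
  · simp; omega
  · exact hp.mapLe _
  · intro e he
    simp only [SimpleGraph.Walk.edges_mapLe_eq_edges, List.mem_toFinset] at he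
    have := p.edges_subset_edgeSet he
    rw [SimpleGraph.edgeSet_fromEdgeSet] at this
    exact Finset.mem_coe.1 this.1

open Classical in
/-- The connection probability of two vertices under bond percolation with edge probabilities at
most `r`, by a union bound over self-avoiding paths. -/
lemma percolation_le {n : ℕ} {u v : Fin n} (huv : u ≠ v) (q : Sym2 (Fin n) → ℝ) {r : ℝ}
    (hq0 : ∀ e, 0 ≤ q e) (hqr : ∀ e, q e ≤ r) (hq1 : ∀ e, q e ≤ 1) :
    ∑ S ∈ (Finset.univ : Finset (Sym2 (Fin n))).powerset,
      ((∏ e ∈ S, q e) * ∏ e ∈ Finset.univ \ S, (1 - q e)) *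
        (if (SimpleGraph.fromEdgeSet (S : Set (Sym2 (Fin n)))).Reachable u v then 1 else 0) ≤
      ∑ j ∈ Finset.range n, (n.descFactorial j : ℝ) * r ^ (j + 1) := by
  have hr0 : 0 ≤ r := (hq0 s(u, v)).trans (hqr _)
  calc _ ≤ ∑ S ∈ (Finset.univ : Finset (Sym2 (Fin n))).powerset,
      ((∏ e ∈ S, q e) * ∏ e ∈ Finset.univ \ S, (1 - q e)) *
        ∑ j ∈ Finset.range n, ∑ p ∈ completePaths u v (j + 1),
          (if p.edges.toFinset ⊆ S then (1 : ℝ) else 0) := by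
        refine Finset.sum_le_sum fun S _ => mul_le_mul_of_nonneg_left ?_
          (mul_nonneg (Finset.prod_nonneg fun e _ => hq0 e)
            (Finset.prod_nonneg fun e _ => by linarith [hq1 e]))
        have hnn : ∀ p : (⊤ : SimpleGraph (Fin n)).Walk u v,
            (0 : ℝ) ≤ if p.edges.toFinset ⊆ S then (1 : ℝ) else 0 := fun p => by
          split_ifs <;> norm_num
        split_ifs with h
        · obtain ⟨j, hj, p, hp, hpS⟩ := exists_completePath_of_reachable huv h
          calc (1 : ℝ) = if p.edges.toFinset ⊆ S then (1 : ℝ) else 0 := (if_pos hpS).symm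
            _ ≤ ∑ p ∈ completePaths u v (j + 1),
                (if p.edges.toFinset ⊆ S then (1 : ℝ) else 0) :=
              Finset.single_le_sum (f := fun p : (⊤ : SimpleGraph (Fin n)).Walk u v =>
                if p.edges.toFinset ⊆ S then (1 : ℝ) else 0) (fun p _ => hnn p) hp
            _ ≤ _ := Finset.single_le_sum (f := fun j => ∑ p ∈ completePaths u v (j + 1),
                (if p.edges.toFinset ⊆ S then (1 : ℝ) else 0))
                (fun j _ => Finset.sum_nonneg fun p _ => hnn p) hj
        · exact Finset.sum_nonneg fun j _ => Finset.sum_nonneg fun p _ => hnn p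
    _ = ∑ j ∈ Finset.range n, ∑ p ∈ completePaths u v (j + 1), ∏ e ∈ p.edges.toFinset, q e := by
        simp only [Finset.mul_sum]
        rw [Finset.sum_comm]
        refine Finset.sum_congr rfl fun j _ => ?_
        rw [Finset.sum_comm]
        exact Finset.sum_congr rfl fun p _ =>
          sum_powerset_weight_of_subset q (Finset.subset_univ _)
    _ ≤ ∑ j ∈ Finset.range n, ∑ p ∈ completePaths u v (j + 1), r ^ (j + 1) := by
        refine Finset.sum_le_sum fun j _ => Finset.sum_le_sum fun p hp => ?_
        obtain ⟨hl, hpp⟩ := mem_completePaths.1 hp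
        -- A path repeats no edge, so the product has exactly $j+1$ factors.
        have hc : p.edges.toFinset.card = j + 1 := by
          rw [List.toFinset_card_of_nodup hpp.isTrail.edges_nodup, SimpleGraph.Walk.length_edges,
            hl]
        rw [← hc]
        exact (Finset.prod_le_prod (fun e _ => hq0 e) (fun e _ => hqr e)).trans_eq
          (Finset.prod_const r)
    _ ≤ _ := by
        refine Finset.sum_le_sum fun j _ => ?_
        rw [Finset.sum_const, nsmul_eq_mul]
        exact mul_le_mul_of_nonneg_right (by exact_mod_cast card_completePaths_le u v j)
          (pow_nonneg hr0 _)

/-! ### The path sum at criticality -/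

/-- Birthday probabilities decay geometrically: `m + j` uniform samples from `n` values are distinct
with probability at most `(1 - m / n) ^ j`. -/
lemma descFactorial_mul_pow_le {n m j : ℕ} (hn : 0 < n) (hmn : m ≤ n) :
    (n.descFactorial (m + j) : ℝ) * (1 / n : ℝ) ^ (m + j) ≤ (1 - m / n : ℝ) ^ j := by
  have hn' : (0 : ℝ) < n := by exact_mod_cast hn
  have h1 : (m : ℝ) / n ≤ 1 := by
    rw [div_le_one hn']; exact_mod_cast hmn
  induction j with
  | zero =>
    have := Nat.descFactorial_le_pow n m
    have : (n.descFactorial m : ℝ) ≤ (n : ℝ) ^ m := by exact_mod_cast this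
    simp only [add_zero, pow_zero, one_div, inv_pow]
    rwa [← div_eq_mul_inv, div_le_one (by positivity)]
  | succ j ih =>
    -- The next sample must avoid $m+j\ge m$ values already taken.
    have hsub : ((n - (m + j) : ℕ) : ℝ) / n ≤ 1 - m / n := by
      rw [div_le_iff₀ hn', sub_mul, one_mul, div_mul_cancel₀ _ hn'.ne']
      have : n - (m + j) ≤ n - m := by omega
      have : ((n - (m + j) : ℕ) : ℝ) ≤ ((n - m : ℕ) : ℝ) := by exact_mod_cast this
      rwa [Nat.cast_sub hmn] at this
    calc (n.descFactorial (m + (j + 1)) : ℝ) * (1 / n : ℝ) ^ (m + (j + 1))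
        = (((n - (m + j) : ℕ) : ℝ) / n) *
          ((n.descFactorial (m + j) : ℝ) * (1 / n : ℝ) ^ (m + j)) := by
          rw [← add_assoc, Nat.descFactorial_succ, pow_succ]; push_cast; ring
      _ ≤ (1 - m / n) * (1 - m / n) ^ j :=
          mul_le_mul hsub ih (by positivity) (by linarith)
      _ = _ := by ring

/-- The first `m` terms are at most $1/n$ each. The later ones are dominated by a geometric series
of ratio $1-m/n$, whose sum $n/m$ is multiplied by $1/n$. Any $1\ll m\ll n$ thus makes the bound
small. -/
lemma sum_descFactorial_le {n m : ℕ} (hm : 0 < m) (hmn : m ≤ n) :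
    ∑ j ∈ Finset.range n, (n.descFactorial j : ℝ) * (1 / n : ℝ) ^ (j + 1) ≤ m / n + 1 / m := by
  have hn : 0 < n := hm.trans_le hmn
  have hn' : (0 : ℝ) < n := by exact_mod_cast hn
  have hm' : (0 : ℝ) < m := by exact_mod_cast hm
  have h1 : (m : ℝ) / n ≤ 1 := by
    rw [div_le_one hn']; exact_mod_cast hmn
  have hx0 : 0 ≤ (1 - m / n : ℝ) := by linarith
  have hx1 : (1 - m / n : ℝ) < 1 := by have := div_pos hm' hn'; linarith
  obtain ⟨k, rfl⟩ := Nat.exists_eq_add_of_le hmn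
  rw [Finset.sum_range_add]
  set N := m + k
  refine add_le_add ?_ ?_
  · calc _ ≤ ∑ _j ∈ Finset.range m, (1 / N : ℝ) := by
          refine Finset.sum_le_sum fun j _ => ?_
          have := descFactorial_mul_pow_le (m := 0) (j := j) hn (Nat.zero_le _)
          rw [zero_add] at this
          rw [pow_succ, ← mul_assoc]
          refine mul_le_of_le_one_left (by positivity) (by simpa using this)
      _ = _ := by simp [div_eq_mul_inv]
  · calc _ ≤ ∑ j ∈ Finset.range k, (1 - m / N : ℝ) ^ j * (1 / N) := by
          refine Finset.sum_le_sum fun j _ => ?_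
          rw [pow_succ, ← mul_assoc]
          exact mul_le_mul_of_nonneg_right (descFactorial_mul_pow_le hn hmn) (by positivity)
      _ = (∑ j ∈ Finset.range k, (1 - m / N : ℝ) ^ j) * (1 / N) := by rw [Finset.sum_mul]
      _ ≤ (1 - (1 - m / N : ℝ))⁻¹ * (1 / N) := by
          refine mul_le_mul_of_nonneg_right ?_ (by positivity)
          rw [← tsum_geometric_of_lt_one hx0 hx1]
          exact (summable_geometric_of_lt_one hx0 hx1).sum_le_tsum _
            (fun i _ => pow_nonneg hx0 i)
      _ = 1 / m := by rw [sub_sub_cancel]; field_simp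

lemma eventually_sum_descFactorial_le {η : ℝ} (hη : 0 < η) :
    ∀ᶠ n : ℕ in atTop,
      ∑ j ∈ Finset.range n, (n.descFactorial j : ℝ) * (1 / n : ℝ) ^ (j + 1) ≤ η := by
  obtain ⟨m, hm⟩ := exists_nat_gt (2 / η)
  have hm' : (0 : ℝ) < m := (by positivity : 0 < 2 / η).trans hm
  have hm0 : 0 < m := by exact_mod_cast hm'
  obtain ⟨N, hN⟩ := exists_nat_gt (2 * m / η)
  filter_upwards [eventually_ge_atTop (max m N)] with n hn
  refine (sum_descFactorial_le hm0 ((le_max_left _ _).trans hn)).trans ?_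
  have hNn : (N : ℝ) ≤ n := by exact_mod_cast (le_max_right _ _).trans hn
  have hn' : (0 : ℝ) < n := (by positivity : 0 < 2 * m / η).trans (hN.trans_le hNn)
  have a1 : (m : ℝ) / n ≤ η / 2 := by
    rw [div_le_iff₀ hn']
    have := (div_lt_iff₀ hη).1 (hN.trans_le hNn)
    linarith
  have a2 : 1 / (m : ℝ) ≤ η / 2 := by
    rw [div_le_iff₀ hm']
    have := (div_lt_iff₀ hη).1 hm
    linarith
  linarith


/-! ### The block model as a family of channels -/

/-- The channel through which the relative sign of the two ends of a pair is observed; the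
diagonal pairs are always erased. -/
noncomputable def edgeChannel (c : ℝ) (ε : unitInterval) (n : ℕ) (e : Sym2 (Fin n)) : ℝ × ℝ :=
  (if e.IsDiag then 0 else (edgeProb c n : ℝ), 1 - 2 * (ε : ℝ))

/-- The relative sign of the two ends of a pair. -/
def relSign {n : ℕ} (e : Sym2 (Fin n)) (x : Spins n) : ℤˣ := (e.map x).mul

/-- The joint weight of the spins `x` and the observation `y`. -/
noncomputable def jointWeight (c : ℝ) (ε : unitInterval) (n : ℕ) (y : Observation n)
    (x : Spins n) : ℝ :=
  1 / 2 ^ n * ∏ e, channel (edgeChannel c ε n e) (y e) (relSign e x)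

lemma admissible_edgeChannel (c : ℝ) (ε : unitInterval) (n : ℕ) (e : Sym2 (Fin n)) :
    Admissible (edgeChannel c ε n e) := by
  have h := (edgeProb c n).2
  have hε := ε.2
  refine ⟨?_, ?_, ?_, ?_⟩ <;> simp only [edgeChannel]
  · split_ifs
    · exact le_rfl
    · exact h.1
  · split_ifs
    · exact zero_le_one
    · exact h.2
  · linarith [hε.2]
  · linarith [hε.1]

lemma jointWeight_nonneg (c : ℝ) (ε : unitInterval) (n : ℕ) (y : Observation n) (x : Spins n) :
    0 ≤ jointWeight c ε n y x :=
  mul_nonneg (by positivity)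
    (Finset.prod_nonneg fun e _ => channel_nonneg (admissible_edgeChannel c ε n e) _ _)

instance (c : ℝ) (ε : unitInterval) (n : ℕ) : IsProbabilityMeasure (law c ε n) := by
  unfold law; infer_instance

instance : MeasurableSingletonClass ℤˣ :=
  ⟨fun s => ⟨{(s : ℤ)}, measurableSet_singleton _, by ext t; simp [Units.ext_iff]⟩⟩

instance (n : ℕ) : MeasurableSingletonClass (SimpleGraph (Fin n)) :=
  ⟨fun G => by
    have := SimpleGraph.measurableEmbedding_edgeSet.measurable
      (measurableSet_singleton (G.edgeSet : Set (Sym2 (Fin n))))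
    convert this using 1
    ext H
    simp⟩

open Classical in
-- The product runs over all pairs, with trivial factors on the diagonal, so as to match
-- `jointWeight` factor by factor.
lemma binomialRandom_real_singleton_eq_prod {n : ℕ} (p : unitInterval)
    (G : SimpleGraph (Fin n)) :
    (SimpleGraph.binomialRandom (Fin n) p).real {G} =
      ∏ e, (if e ∈ G.edgeSet then (p : ℝ) else if e.IsDiag then 1 else 1 - (p : ℝ)) := by
  rw [measureReal_def, SimpleGraph.binomialRandom_apply, Set.image_singleton,
    Measure.infinitePi_eq_pi, Measure.pi_singleton, ENNReal.toReal_prod]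
  refine Finset.prod_congr rfl fun e _ => ?_
  by_cases he : e ∈ G.edgeSet
  · have hd : ¬ e.IsDiag := G.not_isDiag_of_mem_edgeSet he
    simp [he, hd]
  · by_cases hd : e.IsDiag
    · simp [he, hd, ← ENNReal.coe_add]
    · simp [he, hd]

lemma measureReal_pi_univ {ι : Type*} [Fintype ι] {α : Type*} [MeasurableSpace α]
    (μ : ι → Measure α) [∀ i, SigmaFinite (μ i)] (s : ι → Set α) :
    (Measure.pi μ).real (Set.univ.pi s) = ∏ i, (μ i).real (s i) := by
  rw [measureReal_def, Measure.pi_pi, ENNReal.toReal_prod]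
  rfl

lemma uniformOn_real_singleton {n : ℕ} (x : Spins n) :
    (uniformOn (Set.univ : Set (Spins n))).real {x} = 1 / 2 ^ n := by
  rw [measureReal_def, uniformOn_univ, Measure.count_singleton]
  simp

open Classical in
lemma bernoulli_real_noise (ε : unitInterval) (t s : ℤˣ) :
    (bernoulliMeasure (-1 : ℤˣ) 1 ε).real {z | t = s * z} =
      (1 + (1 - 2 * (ε : ℝ)) * (((t * s : ℤˣ) : ℤ) : ℝ)) / 2 := by
  rw [bernoulliMeasure_real_apply _ (Set.toFinite _).measurableSet]
  rcases Int.units_eq_one_or t with rfl | rfl <;> rcases Int.units_eq_one_or s with rfl | rfl <;>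
    simp <;> ring

open Classical in
lemma observe_apply {n : ℕ} (G : SimpleGraph (Fin n)) (x : Spins n) (z : Sym2 (Fin n) → ℤˣ)
    (e : Sym2 (Fin n)) :
    observe (G, x, z) e = if e ∈ G.edgeSet then some (relSign e x * z e) else none := rfl

/-- The joint law of the spins and the observation. -/
lemma law_real_spins_observe (c : ℝ) (ε : unitInterval) (n : ℕ) (x : Spins n)
    (y : Observation n) :
    (law c ε n).real {ω | spins ω = x ∧ observe ω = y} = jointWeight c ε n y x := by
  classical
  -- A label on a diagonal pair is impossible under the law, and it has weight zero because
  -- `edgeChannel` always erases the diagonal.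
  by_cases hy : ∃ e : Sym2 (Fin n), e.IsDiag ∧ y e ≠ none
  · obtain ⟨e, hd, he⟩ := hy
    have hempty : {ω : Sample n | spins ω = x ∧ observe ω = y} = ∅ := by
      refine Set.eq_empty_iff_forall_notMem.2 fun ω hω => he ?_
      rw [← hω.2, observe, if_neg fun h => ω.1.not_isDiag_of_mem_edgeSet h hd]
    rw [hempty, measureReal_empty, jointWeight, Finset.prod_eq_zero (Finset.mem_univ e), mul_zero]
    obtain ⟨t, ht⟩ := Option.ne_none_iff_exists'.1 he
    rw [ht]
    simp [channel, edgeChannel, hd]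
  · push Not at hy
    set G := SimpleGraph.fromEdgeSet {e | y e ≠ none} with hG
    have hmem : ∀ e, e ∈ G.edgeSet ↔ y e ≠ none := by
      intro e
      rw [hG, SimpleGraph.edgeSet_fromEdgeSet]
      exact ⟨fun h => h.1, fun h => ⟨h, fun hd => h (hy e hd)⟩⟩
    -- The observation determines the graph, so the event is a box; on non-edges the noise is
    -- unconstrained.
    have hset : {ω : Sample n | spins ω = x ∧ observe ω = y} =
        {G} ×ˢ ({x} ×ˢ Set.univ.pi fun e => {z | ∀ t, y e = some t → t = relSign e x * z}) := by
      ext ⟨H, x', z⟩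
      simp only [Set.mem_ofPred_eq, Set.mem_prod, Set.mem_singleton_iff, Set.mem_univ_pi, spins]
      constructor
      · rintro ⟨rfl, ho⟩
        refine ⟨?_, rfl, fun e t ht => ?_⟩
        · rw [← SimpleGraph.edgeSet_inj]
          ext e
          rw [hmem, ← ho, observe_apply]
          by_cases h : e ∈ H.edgeSet <;> simp [h]
        · rw [← ho, observe_apply] at ht
          by_cases h : e ∈ H.edgeSet
          · simpa [h, eq_comm] using ht
          · simp [h] at ht
      · rintro ⟨rfl, rfl, hz⟩
        refine ⟨rfl, ?_⟩
        funext e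
        by_cases h : e ∈ G.edgeSet
        · rw [observe_apply, if_pos h]
          obtain ⟨t, ht⟩ := Option.ne_none_iff_exists'.1 ((hmem e).1 h)
          rw [ht, ← hz e t ht]
        · rw [observe_apply, if_neg h]
          exact (not_not.1 fun h' => h ((hmem e).2 h')).symm
    rw [hset, law, measureReal_prod_prod, measureReal_prod_prod,
      binomialRandom_real_singleton_eq_prod, uniformOn_real_singleton, measureReal_pi_univ,
      jointWeight, mul_left_comm, ← Finset.prod_mul_distrib]
    congr 1
    refine Finset.prod_congr rfl fun e _ => ?_
    rcases hye : y e with _ | t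
    · have : e ∉ G.edgeSet := fun h => (hmem e).1 h hye
      by_cases hd : e.IsDiag <;> simp [this, hd, channel, edgeChannel]
    · have he : e ∈ G.edgeSet := (hmem e).2 (by simp [hye])
      have hd := G.not_isDiag_of_mem_edgeSet he
      have hs : {z | ∀ t', (some t : EdgeLabel) = some t' → t' = relSign e x * z} =
          {z | t = relSign e x * z} := by
        ext z; simp
      rw [if_pos he, hs, bernoulli_real_noise]
      simp [channel, edgeChannel, hd]

instance (n : ℕ) : DiscreteMeasurableSpace (Sample n) :=
  inferInstance


/-! ### Information percolation for a pair of spins -/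

/-- The sign of a unit, as a real number. -/
def sgn (s : ℤˣ) : ℝ := ((s : ℤ) : ℝ)

lemma sgn_neg (s : ℤˣ) : sgn (-s) = -sgn s := by simp [sgn]

lemma abs_sgn (s : ℤˣ) : |sgn s| = 1 := by
  rcases Int.units_eq_one_or s with h | h <;> simp [sgn, h]

/-- The Fourier expansion of an indicator; it reduces the laws of one and two spins to their sign
moments. -/
lemma sgn_indicator (a s : ℤˣ) : (if s = a then (1 : ℝ) else 0) = (1 + sgn a * sgn s) / 2 := by
  rcases Int.units_eq_one_or s with rfl | rfl <;> rcases Int.units_eq_one_or a with rfl | rfl <;>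
    norm_num [sgn]

lemma sum_units (g : ℤˣ → ℝ) : ∑ a, g a = g 1 + g (-1) := by
  rw [show (Finset.univ : Finset ℤˣ) = {1, -1} from rfl, Finset.sum_pair (by decide)]

/-- The relative sign of two vertices. -/
def pairSign {n : ℕ} (u v : Fin n) (x : Spins n) : ℝ := sgn (x u) * sgn (x v)

lemma abs_pairSign {n : ℕ} (u v : Fin n) (x : Spins n) : |pairSign u v x| = 1 := by
  rw [pairSign, abs_mul, abs_sgn, abs_sgn, one_mul]

/-- The mean square of the posterior correlation of the spins at `u` and `v`. -/
noncomputable def pairInfo (c : ℝ) (ε : unitInterval) (n : ℕ) (u v : Fin n) : ℝ :=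
  ∑ y, sqCorr (pairSign u v) (jointWeight c ε n y)

lemma pairInfo_eq_meanSqCorr (c : ℝ) (ε : unitInterval) (n : ℕ) (u v : Fin n) :
    pairInfo c ε n u v =
      meanSqCorr (pairSign u v) (fun _ => 1 / 2 ^ n) relSign (edgeChannel c ε n) := rfl

/-- Flip the spins in a set of vertices. -/
def flipOn {n : ℕ} (C : Fin n → Prop) [DecidablePred C] (x : Spins n) : Spins n :=
  fun i => if C i then -x i else x i

lemma flipOn_involutive {n : ℕ} (C : Fin n → Prop) [DecidablePred C] :
    Function.Involutive (flipOn C) := by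
  intro x
  funext i
  by_cases h : C i <;> simp [flipOn, h]

lemma relSign_mk {n : ℕ} (a b : Fin n) (x : Spins n) : relSign s(a, b) x = x a * x b := rfl

lemma relSign_flipOn {n : ℕ} (C : Fin n → Prop) [DecidablePred C] (x : Spins n) (a b : Fin n)
    (h : C a ↔ C b) : relSign s(a, b) (flipOn C x) = relSign s(a, b) x := by
  rw [relSign_mk, relSign_mk]
  by_cases hb : C b
  · simp [flipOn, h.2 hb, hb]
  · have : ¬ C a := fun ha => hb (h.1 ha)
    simp [flipOn, this, hb]

lemma sum_prior (n : ℕ) : ∑ _x : Spins n, (1 / 2 ^ n : ℝ) = 1 := by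
  simp

open Classical in
/-- The information percolation bound. -/
lemma pairInfo_le_percolation (c : ℝ) (ε : unitInterval) (n : ℕ) (u v : Fin n) :
    pairInfo c ε n u v ≤ ∑ S ∈ (Finset.univ : Finset (Sym2 (Fin n))).powerset,
      ((∏ e ∈ S, (edgeChannel c ε n e).1 * (edgeChannel c ε n e).2 ^ 2) *
        ∏ e ∈ Finset.univ \ S, (1 - (edgeChannel c ε n e).1 * (edgeChannel c ε n e).2 ^ 2)) *
        (if (SimpleGraph.fromEdgeSet (S : Set (Sym2 (Fin n)))).Reachable u v then 1 else 0) := by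
  have hadm := admissible_edgeChannel c ε n
  rw [pairInfo_eq_meanSqCorr]
  refine (meanSqCorr_le_sum_powerset _ _ (fun _ => by positivity) _ _ hadm Finset.univ).trans ?_
  refine Finset.sum_le_sum fun S _ => mul_le_mul_of_nonneg_left ?_ ?_
  · split_ifs with h
    · refine meanSqCorr_le_one _ _ (fun x => (abs_pairSign u v x).le) (fun _ => by positivity)
        (sum_prior n) _ _ fun e => ?_
      split_ifs
      · norm_num [Admissible]
      · norm_num [Admissible]
      · exact hadm e
    -- Flipping the component of `u` preserves every revealed relative sign and, since `v` lies
    -- outside it, reverses the sign of the pair.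
    · set H := SimpleGraph.fromEdgeSet (S : Set (Sym2 (Fin n))) with hH
      refine (meanSqCorr_eq_zero_of_symm _ _ _ _
        ((flipOn_involutive fun i => H.Reachable u i).toPerm) ?_ (fun _ => rfl) ?_).le
      · intro x
        simp [pairSign, flipOn, h, sgn_neg]
      · intro e x
        by_cases he : e ∈ S
        · right
          induction e using Sym2.ind with
          | _ a b =>
            refine relSign_flipOn _ x a b ?_
            rcases eq_or_ne a b with rfl | hab
            · rfl
            · have hadj : H.Adj a b := (SimpleGraph.fromEdgeSet_adj _).2 ⟨he, hab⟩
              exact ⟨fun h => h.trans hadj.reachable, fun h => h.trans hadj.symm.reachable⟩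
        · left
          simp [he]
  · have hq : ∀ e, 0 ≤ (edgeChannel c ε n e).1 * (edgeChannel c ε n e).2 ^ 2 ∧
        (edgeChannel c ε n e).1 * (edgeChannel c ε n e).2 ^ 2 ≤ 1 := by
      intro e
      obtain ⟨h0, h1, h2, h3⟩ := hadm e
      have : (edgeChannel c ε n e).2 ^ 2 ≤ 1 := by nlinarith
      exact ⟨by positivity, mul_le_one₀ h1 (sq_nonneg _) this⟩
    exact mul_nonneg (Finset.prod_nonneg fun e _ => (hq e).1)
      (Finset.prod_nonneg fun e _ => by linarith [(hq e).2])

lemma edgeProb_le {c : ℝ} (hc : 0 ≤ c) (n : ℕ) : (edgeProb c n : ℝ) ≤ c / n := by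
  have : 0 ≤ c / n := by positivity
  rw [edgeProb, Set.coe_projIcc]
  exact max_le this (min_le_right _ _)

/-- The threshold enters here only: $c(1-2\varepsilon)^2\le1$ says that each edge is open with
probability at most $1/n$. -/
lemma pairInfo_le {c : ℝ} (hc : 0 ≤ c) {ε : unitInterval}
    (hcε : (ε : ℝ) ≠ 1 / 2 → c ≤ 1 / (1 - 2 * (ε : ℝ)) ^ 2) {n : ℕ} {u v : Fin n} (huv : u ≠ v) :
    pairInfo c ε n u v ≤
      ∑ j ∈ Finset.range n, (n.descFactorial j : ℝ) * (1 / n : ℝ) ^ (j + 1) := by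
  classical
  have hn : (0 : ℝ) < n := by exact_mod_cast u.pos
  have hadm := admissible_edgeChannel c ε n
  have hcρ : c * (1 - 2 * (ε : ℝ)) ^ 2 ≤ 1 := by
    by_cases h : (ε : ℝ) = 1 / 2
    · rw [h]; norm_num
    · have hne : 1 - 2 * (ε : ℝ) ≠ 0 := fun h0 => h (by linarith)
      exact (le_div_iff₀ (by positivity)).1 (hcε h)
  refine (pairInfo_le_percolation c ε n u v).trans
    (percolation_le huv _ (fun e => ?_) (fun e => ?_) (fun e => ?_))
  · exact mul_nonneg (hadm e).1 (sq_nonneg _)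
  · simp only [edgeChannel]
    split_ifs
    · rw [zero_mul]; positivity
    · refine (mul_le_mul_of_nonneg_right (edgeProb_le hc n) (sq_nonneg _)).trans ?_
      rw [div_mul_eq_mul_div]
      gcongr
  · obtain ⟨h0, h1, h2, h3⟩ := hadm e
    exact mul_le_one₀ h1 (sq_nonneg _) (by nlinarith)

/-! ### The $\chi^2$-information as a mean squared posterior correlation -/

lemma law_real_of_spins_observe (c : ℝ) (ε : unitInterval) (n : ℕ) (Q : Spins n → Prop)
    [DecidablePred Q] (y : Observation n) :
    (law c ε n).real {ω | Q (spins ω) ∧ observe ω = y} =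
      ∑ x, (if Q x then 1 else 0) * jointWeight c ε n y x := by
  have hU : {ω : Sample n | Q (spins ω) ∧ observe ω = y} =
      ⋃ x ∈ Finset.univ.filter Q, {ω | spins ω = x ∧ observe ω = y} := by
    ext ω; simp
  rw [hU, measureReal_biUnion_finset]
  · simp only [law_real_spins_observe, Finset.sum_filter, ite_mul, one_mul, zero_mul]
  · intro x _ x' _ hxx
    exact Set.disjoint_left.2 fun ω h h' => hxx (h.1.symm.trans h'.1)
  · exact fun x _ => MeasurableSet.of_discrete

lemma jointWeight_neg (c : ℝ) (ε : unitInterval) (n : ℕ) (y : Observation n) (x : Spins n) :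
    jointWeight c ε n y (-x) = jointWeight c ε n y x := by
  have : ∀ e, relSign e (-x) = relSign e x := by
    intro e
    induction e using Sym2.ind with
    | _ a b => simp [relSign_mk]
  simp only [jointWeight, this]

/-- The labels do not change under a global flip of the spins, so each posterior marginal is
uniform. -/
lemma sum_sgn_mul_jointWeight (c : ℝ) (ε : unitInterval) (n : ℕ) (y : Observation n) (u : Fin n) :
    ∑ x, sgn (x u) * jointWeight c ε n y x = 0 := by
  have : ∑ x, sgn (x u) * jointWeight c ε n y x = -∑ x, sgn (x u) * jointWeight c ε n y x := by
    conv_lhs => rw [← Equiv.sum_comp (Equiv.neg (Spins n))]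
    simp [jointWeight_neg, sgn_neg]
  linarith

lemma law_real_observe (c : ℝ) (ε : unitInterval) (n : ℕ) (y : Observation n) :
    (law c ε n).real (observe ⁻¹' {y}) = ∑ x, jointWeight c ε n y x := by
  have := law_real_of_spins_observe c ε n (fun _ => True) y
  simpa [Set.preimage] using this

lemma law_real_observe_spin (c : ℝ) (ε : unitInterval) (n : ℕ) (y : Observation n) (u : Fin n)
    (a : ℤˣ) : (law c ε n).real (observe ⁻¹' {y} ∩ (fun ω => spins ω u) ⁻¹' {a}) =
      (∑ x, jointWeight c ε n y x) / 2 := by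
  have h := law_real_of_spins_observe c ε n (fun x => x u = a) y
  rw [show observe ⁻¹' {y} ∩ (fun ω => spins ω u) ⁻¹' {a} =
    {ω : Sample n | spins ω u = a ∧ observe ω = y} by ext ω; simp [and_comm], h]
  have : ∀ x : Spins n, (if x u = a then (1 : ℝ) else 0) * jointWeight c ε n y x =
      1 / 2 * jointWeight c ε n y x + sgn a / 2 * (sgn (x u) * jointWeight c ε n y x) := by
    intro x; rw [sgn_indicator]; ring
  simp only [this, Finset.sum_add_distrib, ← Finset.mul_sum, sum_sgn_mul_jointWeight]
  ring

lemma law_real_observe_spin_spin (c : ℝ) (ε : unitInterval) (n : ℕ) (y : Observation n)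
    (u v : Fin n) (a b : ℤˣ) : (law c ε n).real
      (observe ⁻¹' {y} ∩ ((fun ω => spins ω u) ⁻¹' {a} ∩ (fun ω => spins ω v) ⁻¹' {b})) =
      (∑ x, jointWeight c ε n y x +
        sgn a * sgn b * ∑ x, pairSign u v x * jointWeight c ε n y x) / 4 := by
  have h := law_real_of_spins_observe c ε n (fun x => x u = a ∧ x v = b) y
  rw [show observe ⁻¹' {y} ∩ ((fun ω => spins ω u) ⁻¹' {a} ∩ (fun ω => spins ω v) ⁻¹' {b}) =
    {ω : Sample n | (spins ω u = a ∧ spins ω v = b) ∧ observe ω = y} by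
      ext ω; simp [and_comm], h]
  have : ∀ x : Spins n,
      (if x u = a ∧ x v = b then (1 : ℝ) else 0) * jointWeight c ε n y x =
      1 / 4 * jointWeight c ε n y x + sgn a / 4 * (sgn (x u) * jointWeight c ε n y x) +
      sgn b / 4 * (sgn (x v) * jointWeight c ε n y x) +
      sgn a * sgn b / 4 * (pairSign u v x * jointWeight c ε n y x) := by
    intro x
    have hand : (if x u = a ∧ x v = b then (1 : ℝ) else 0) =
        (if x u = a then 1 else 0) * (if x v = b then 1 else 0) := by
      split_ifs <;> simp_all
    rw [hand, sgn_indicator, sgn_indicator, pairSign]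
    ring
  simp only [this, Finset.sum_add_distrib, ← Finset.mul_sum, sum_sgn_mul_jointWeight]
  ring

/-- The conditional `χ²`-information of two spins is the mean square of their posterior
correlation. -/
lemma condChiSqInfo_eq_pairInfo (c : ℝ) (ε : unitInterval) (n : ℕ) (u v : Fin n) :
    condChiSqInfo (law c ε n) (fun ω => spins ω u) (fun ω => spins ω v) observe =
      pairInfo c ε n u v := by
  refine Finset.sum_congr rfl fun y _ => ?_
  have hcond : ∀ s, (ProbabilityTheory.cond (law c ε n) (observe ⁻¹' {y})).real s =
      ((law c ε n).real (observe ⁻¹' {y}))⁻¹ * (law c ε n).real (observe ⁻¹' {y} ∩ s) :=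
    fun s => by
      rw [measureReal_def, cond_apply MeasurableSet.of_discrete, ENNReal.toReal_mul,
        ENNReal.toReal_inv]
      rfl
  simp only [chiSqInfo, hcond, law_real_observe_spin, law_real_observe_spin_spin,
    law_real_observe, sqCorr]
  set p := ∑ x, jointWeight c ε n y x
  set m := ∑ x, pairSign u v x * jointWeight c ε n y x
  -- Impossible observations give zero on both sides by the convention on division. Otherwise each
  -- of the four terms is $\tfrac14(m/p)^2$.
  rcases eq_or_ne p 0 with hp | hp
  · simp [hp]
  · simp only [sum_units]
    norm_num [sgn]
    field_simp
    ring


/-! ### From pair correlations to the overlap -/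

lemma sum_jointWeight (c : ℝ) (ε : unitInterval) (n : ℕ) :
    ∑ y, ∑ x, jointWeight c ε n y x = 1 := by
  rw [Finset.sum_comm]
  simp only [jointWeight, ← Finset.mul_sum, sum_prod_channel, mul_one]
  exact sum_prior n

lemma abs_corr_le (c : ℝ) (ε : unitInterval) (n : ℕ) (u v : Fin n) (y : Observation n) :
    |∑ x, pairSign u v x * jointWeight c ε n y x| ≤ ∑ x, jointWeight c ε n y x := by
  refine (Finset.abs_sum_le_sum_abs _ _).trans (Finset.sum_le_sum fun x _ => ?_)
  rw [abs_mul, abs_pairSign, one_mul, abs_of_nonneg (jointWeight_nonneg c ε n y x)]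

/-- The mean absolute posterior correlation is at most the square root of the mean square. -/
lemma sum_abs_corr_le {c : ℝ} {ε : unitInterval} {n : ℕ} {u v : Fin n} {t : ℝ} (ht : 0 < t)
    (h : pairInfo c ε n u v ≤ t ^ 2) :
    ∑ y, |∑ x, pairSign u v x * jointWeight c ε n y x| ≤ t := by
  -- The arithmetic-geometric mean inequality with parameter `t` replaces Cauchy–Schwarz; after
  -- averaging, each of the two terms is at most $t/2$.
  have hpt : ∀ y, |∑ x, pairSign u v x * jointWeight c ε n y x| ≤
      sqCorr (pairSign u v) (jointWeight c ε n y) / (2 * t) +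
        t / 2 * ∑ x, jointWeight c ε n y x := by
    intro y
    have hm := abs_corr_le c ε n u v y
    rw [sqCorr, ← sq_abs]
    set p := ∑ x, jointWeight c ε n y x
    set m := |∑ x, pairSign u v x * jointWeight c ε n y x|
    have hm0 : 0 ≤ m := abs_nonneg _
    rcases (hm0.trans hm).eq_or_lt with hp | hp
    · rw [← hp] at hm ⊢
      simpa using hm
    · have : m ^ 2 / p / (2 * t) + t / 2 * p - m = (m - t * p) ^ 2 / (2 * t * p) := by
        field_simp; ring
      have : 0 ≤ (m - t * p) ^ 2 / (2 * t * p) := by positivity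
      linarith
  calc _ ≤ ∑ y, (sqCorr (pairSign u v) (jointWeight c ε n y) / (2 * t) +
        t / 2 * ∑ x, jointWeight c ε n y x) := Finset.sum_le_sum fun y _ => hpt y
    _ = pairInfo c ε n u v / (2 * t) + t / 2 := by
        rw [Finset.sum_add_distrib, ← Finset.sum_div, ← Finset.mul_sum, sum_jointWeight, mul_one,
          pairInfo]
    _ ≤ t ^ 2 / (2 * t) + t / 2 := by gcongr
    _ = t := by field_simp; ring

lemma overlap_sq {n : ℕ} (x x' : Spins n) :
    overlap x x' ^ 2 = (∑ i, ∑ j, pairSign i j x * pairSign i j x') / n ^ 2 := by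
  rw [overlap, div_pow, sq_abs, sq, Finset.sum_mul_sum]
  congr 1
  refine Finset.sum_congr rfl fun i _ => Finset.sum_congr rfl fun j _ => ?_
  simp only [pairSign, sgn]
  push_cast
  ring

/-- Second moment bound for the probability that a random estimate has large overlap with `x`. -/
lemma real_overlap_le {n : ℕ} (ν : Measure (Spins n)) [IsProbabilityMeasure ν] (x : Spins n)
    {δ : ℝ} (hδ : 0 < δ) :
    ν.real {x' | δ ≤ overlap x x'} ≤
      ∑ x', ν.real {x'} * (overlap x x' ^ 2 / δ ^ 2) := by
  classical
  have : {x' | δ ≤ overlap x x'} = ↑(Finset.univ.filter fun x' => δ ≤ overlap x x') := by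
    ext; simp
  rw [this, ← sum_measureReal_singleton, Finset.sum_filter]
  refine Finset.sum_le_sum fun x' _ => ?_
  split_ifs with h
  · refine le_mul_of_one_le_right measureReal_nonneg ?_
    rw [one_le_div (by positivity)]
    gcongr
  · positivity

/-- The integrand depends on the sample only through the spins and the observation, so the integral
is a finite sum against `jointWeight`. -/
lemma overlapProb_eq (c : ℝ) (ε : unitInterval) (est : Estimator) (δ : ℝ) (n : ℕ) :
    overlapProb c ε est δ n = ENNReal.ofReal (∑ y, ∑ x, jointWeight c ε n y x *
      (est.kernel n y).real {x' | δ ≤ overlap x x'}) := by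
  have := est.isMarkov n
  have hmeas : Measurable fun ω : Sample n => (spins ω, observe ω) := Measurable.of_discrete
  have h1 : overlapProb c ε est δ n = ∫⁻ p : Spins n × Observation n,
      est.kernel n p.2 {x' | δ ≤ overlap p.1 x'}
        ∂(law c ε n).map fun ω : Sample n => (spins ω, observe ω) := by
    rw [lintegral_map Measurable.of_discrete hmeas, overlapProb]
  rw [h1, lintegral_fintype, Fintype.sum_prod_type_right, ENNReal.ofReal_sum_of_nonneg]
  · refine Finset.sum_congr rfl fun y _ => ?_
    rw [ENNReal.ofReal_sum_of_nonneg]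
    · refine Finset.sum_congr rfl fun x _ => ?_
      rw [Measure.map_apply hmeas (measurableSet_singleton _),
        show (fun ω : Sample n => (spins ω, observe ω)) ⁻¹' {(x, y)} =
          {ω | spins ω = x ∧ observe ω = y} by ext ω; simp,
        ENNReal.ofReal_mul (jointWeight_nonneg c ε n y x), ← law_real_spins_observe,
        ofReal_measureReal, ofReal_measureReal, mul_comm]
    · exact fun x _ => mul_nonneg (jointWeight_nonneg c ε n y x) measureReal_nonneg
  · exact fun y _ => Finset.sum_nonneg fun x _ =>
      mul_nonneg (jointWeight_nonneg c ε n y x) measureReal_nonneg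

/-- The mean of the product of the planted and the estimated relative signs. -/
lemma sum_pairSign_le (c : ℝ) (ε : unitInterval) {n : ℕ} (ν : Observation n → Measure (Spins n))
    [∀ y, IsProbabilityMeasure (ν y)] (i j : Fin n) :
    ∑ y, ∑ x, jointWeight c ε n y x *
        ∑ x', (ν y).real {x'} * (pairSign i j x * pairSign i j x') ≤
      ∑ y, |∑ x, pairSign i j x * jointWeight c ε n y x| := by
  refine Finset.sum_le_sum fun y _ => ?_
  set m := ∑ x, pairSign i j x * jointWeight c ε n y x with hm
  have hν : ∑ x', (ν y).real {x'} = 1 := by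
    rw [sum_measureReal_singleton, Finset.coe_univ, probReal_univ]
  calc _ = ∑ x', (ν y).real {x'} * (pairSign i j x' * m) := by
        simp only [hm, Finset.mul_sum]
        rw [Finset.sum_comm]
        exact Finset.sum_congr rfl fun _ _ => Finset.sum_congr rfl fun _ _ => by ring
    _ ≤ ∑ x', (ν y).real {x'} * |m| := by
        refine Finset.sum_le_sum fun x' _ => mul_le_mul_of_nonneg_left ?_ measureReal_nonneg
        refine (le_abs_self _).trans_eq ?_
        rw [abs_mul, abs_pairSign, one_mul]
    _ = |m| := by rw [← Finset.sum_mul, hν, one_mul]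

/-- Chebyshev's inequality for the overlap. Of the $n^2$ pairs, the $n$ diagonal ones account for
$1/n$ and all the others together for at most $t$. -/
lemma overlapProb_le {c : ℝ} {ε : unitInterval} (est : Estimator) {δ : ℝ} (hδ : 0 < δ) {n : ℕ}
    (hn : 0 < n) {t : ℝ} (ht : 0 < t)
    (h : ∀ u v : Fin n, u ≠ v → pairInfo c ε n u v ≤ t ^ 2) :
    overlapProb c ε est δ n ≤ ENNReal.ofReal ((1 / n + t) / δ ^ 2) := by
  have := est.isMarkov n
  have hn' : (0 : ℝ) < n := by exact_mod_cast hn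
  rw [overlapProb_eq]
  refine ENNReal.ofReal_le_ofReal ?_
  have hpair : ∀ i j : Fin n, ∑ y, ∑ x, jointWeight c ε n y x *
      ∑ x', (est.kernel n y).real {x'} * (pairSign i j x * pairSign i j x') ≤
      (if i = j then 1 else 0) + t := by
    intro i j
    refine (sum_pairSign_le c ε (fun y => est.kernel n y) i j).trans ?_
    split_ifs with hij
    · refine (Finset.sum_le_sum fun y _ => abs_corr_le c ε n i j y).trans ?_
      rw [sum_jointWeight]
      linarith
    · rw [zero_add]
      exact sum_abs_corr_le ht (h i j hij)
  calc _ ≤ ∑ y, ∑ x, jointWeight c ε n y x *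
        ∑ x', (est.kernel n y).real {x'} * (overlap x x' ^ 2 / δ ^ 2) :=
        Finset.sum_le_sum fun y _ => Finset.sum_le_sum fun x _ =>
          mul_le_mul_of_nonneg_left (real_overlap_le _ x hδ) (jointWeight_nonneg c ε n y x)
    _ = (∑ i, ∑ j, ∑ y, ∑ x, jointWeight c ε n y x *
        ∑ x', (est.kernel n y).real {x'} * (pairSign i j x * pairSign i j x')) /
          (n ^ 2 * δ ^ 2) := by
        have e1 : ∀ y x, jointWeight c ε n y x *
            ∑ x', (est.kernel n y).real {x'} * (overlap x x' ^ 2 / δ ^ 2) =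
            (∑ i, ∑ j, jointWeight c ε n y x * ∑ x', (est.kernel n y).real {x'} *
              (pairSign i j x * pairSign i j x')) / (n ^ 2 * δ ^ 2) := by
          intro y x
          simp only [overlap_sq, ← Finset.mul_sum]
          rw [mul_div_assoc]
          congr 1
          rw [eq_div_iff (by positivity), Finset.sum_mul]
          have : ∀ x', (est.kernel n y).real {x'} *
              ((∑ i, ∑ j, pairSign i j x * pairSign i j x') / n ^ 2 / δ ^ 2) *
              (n ^ 2 * δ ^ 2) =
              ∑ i, ∑ j, (est.kernel n y).real {x'} * (pairSign i j x * pairSign i j x') := by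
            intro x'
            simp only [← Finset.mul_sum]
            field_simp
          simp only [this]
          rw [Finset.sum_comm]
          exact Finset.sum_congr rfl fun i _ => Finset.sum_comm
        simp only [e1, ← Finset.sum_div]
        congr 1
        calc _ = ∑ y, ∑ i, ∑ x, ∑ j, jointWeight c ε n y x * ∑ x', (est.kernel n y).real {x'} *
              (pairSign i j x * pairSign i j x') :=
              Finset.sum_congr rfl fun y _ => Finset.sum_comm
          _ = ∑ i, ∑ y, ∑ j, ∑ x, jointWeight c ε n y x * ∑ x', (est.kernel n y).real {x'} *
              (pairSign i j x * pairSign i j x') := by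
              rw [Finset.sum_comm]
              exact Finset.sum_congr rfl fun i _ => Finset.sum_congr rfl fun y _ =>
                Finset.sum_comm
          _ = _ := Finset.sum_congr rfl fun i _ => Finset.sum_comm
    _ ≤ (∑ i : Fin n, ∑ j : Fin n, ((if i = j then 1 else 0) + t)) / (n ^ 2 * δ ^ 2) := by
        gcongr with i _ j _
        exact hpair i j
    _ = (1 / n + t) / δ ^ 2 := by
        simp only [Finset.sum_add_distrib, Finset.sum_ite_eq, Finset.mem_univ, if_true,
          Finset.sum_const, Finset.card_univ, Fintype.card_fin, nsmul_eq_mul]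
        field_simp

lemma tendsto_overlapProb {c : ℝ} (hc : 0 ≤ c) {ε : unitInterval}
    (hcε : (ε : ℝ) ≠ 1 / 2 → c ≤ 1 / (1 - 2 * (ε : ℝ)) ^ 2) (est : Estimator) {δ : ℝ}
    (hδ : 0 < δ) : Tendsto (overlapProb c ε est δ) atTop (𝓝 0) := by
  rw [ENNReal.tendsto_nhds_zero]
  intro η hη
  obtain ⟨r, hr0, hr⟩ : ∃ r : ℝ, 0 < r ∧ ENNReal.ofReal r ≤ η := by
    rcases eq_or_ne η ⊤ with rfl | htop
    · exact ⟨1, one_pos, le_top⟩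
    · exact ⟨η.toReal, ENNReal.toReal_pos hη.ne' htop, (ENNReal.ofReal_toReal htop).le⟩
  -- With $1/n\le t$, the bound $(1/n+t)/\delta^2$ is at most $2t/\delta^2=r$.
  set t := r * δ ^ 2 / 2 with htdef
  have ht : 0 < t := by positivity
  have hinv : ∀ᶠ n : ℕ in atTop, (1 / n : ℝ) ≤ t :=
    (tendsto_one_div_atTop_nhds_zero_nat (𝕜 := ℝ)).eventually_le_const ht
  filter_upwards [eventually_sum_descFactorial_le (show 0 < t ^ 2 by positivity), hinv,
    eventually_gt_atTop 0] with n hn hn1 hn0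
  refine (overlapProb_le est hδ hn0 ht fun u v huv => (pairInfo_le hc hcε huv).trans hn).trans
    (le_trans (ENNReal.ofReal_le_ofReal ?_) hr)
  rw [div_le_iff₀ (by positivity)]
  linarith

end CensoredBlockModel

theorem mainTheorem6 (c : ℝ) (hc : 0 ≤ c) (ε : unitInterval)
    (hcε : (ε : ℝ) ≠ 1 / 2 → c ≤ 1 / (1 - 2 * (ε : ℝ)) ^ 2) :
    (∀ η : ℝ, 0 < η → ∀ᶠ n : ℕ in atTop, ∀ u v : Fin n, u ≠ v →
      CensoredBlockModel.condChiSqInfo (CensoredBlockModel.law c ε n)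
        (fun ω => CensoredBlockModel.spins ω u) (fun ω => CensoredBlockModel.spins ω v)
        CensoredBlockModel.observe ≤ η) ∧
    (∀ (est : CensoredBlockModel.Estimator) (δ : ℝ), 0 < δ →
      Tendsto (CensoredBlockModel.overlapProb c ε est δ) atTop (𝓝 0)) ∧
    ¬ CensoredBlockModel.WeakRecoverySolvable c ε := by
  refine ⟨fun η hη => ?_, fun est δ hδ => CensoredBlockModel.tendsto_overlapProb hc hcε est hδ, ?_⟩
  · filter_upwards [CensoredBlockModel.eventually_sum_descFactorial_le hη] with n hn u v huv
    rw [CensoredBlockModel.condChiSqInfo_eq_pairInfo]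
    exact (CensoredBlockModel.pairInfo_le hc hcε huv).trans hn
  · rintro ⟨δ, hδ, est, hest⟩
    exact zero_ne_one
      (tendsto_nhds_unique (CensoredBlockModel.tendsto_overlapProb hc hcε est hδ) hest)
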